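/- For $m\ge 0$ let $P_m$ be the polynomial $$P_m(s)=\sum_{k=0}^m\binom{m}{k}(-1)^k2^{k+1}\frac{(s)_k}{k!},\qquad (s)_0=1,\quad (s)_k=s(s+1)\cdots(s+k-1),$$ and let $$z_m=\gamma+\log 2+\sum_{k=1}^m\binom{m}{k}(-2)^k\zeta(k+1)+(-1)^{m+1}+\sum_{k=1}^m\frac1k ,$$ where $\gamma$ is Euler's constant and $\zeta$ is the Riemann zeta function. Let $\mathcal E^{\pi}$ be the space of functions $f$ analytic in $\{\Re(z)>0\}$ for which there are constants $a<\pi$ and $b>0$ such that for every $\varepsilon>0$ there is $C_\varepsilon$ with $|f(z)|\le C_\varepsilon e^{b\Re(z)}e^{a|\Im(z)|}$ whenever $\Re(z)>\varepsilon$. For $f\in\mathcal E^\pi$ the Ramanujan summation of the series $\sum_{n\ge1}f(n)$ is $$\sum_{n\ge1}^{\mathcal R}f(n)=\frac{f(1)}2+i\int_0^{+\infty}\frac{f(1+it)-f(1-it)}{e^{2\pi t}-1}\,dt .$$ Then, for every integer $m\ge0$, the function $z\mapsto \frac1{z+1}\big(\frac{z-1}{z+1}\big)^m$ belongs to $\mathcal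 E^\pi$, the integral in its Ramanujan summation converges absolutely, and $$\sum_{n\ge1}^{\mathcal R}\frac1{n+1}\Big(\frac{n-1}{n+1}\Big)^m=z_m ;$$ and, for every complex $s$ with $0<\Re(s)<1$, the series $\sum_{m\ge0}z_mP_m(s)$ converges absolutely and $$\zeta(s)=\frac1{s-1}+\sum_{m=0}^{+\infty}z_mP_m(s).$$ -/

import Mathlib

namespace ZetaStrip

/-- The polynomial `P_m(s) = ∑_{k=0}^m C(m,k) (-1)^k 2^(k+1) (s)_k / k!`, where
`(s)_k = s (s+1) ⋯ (s+k-1)` is the rising factorial. -/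
noncomputable def P (m : ℕ) (s : ℂ) : ℂ :=
  ∑ k ∈ Finset.range (m + 1),
    (m.choose k : ℂ) * (-1) ^ k * 2 ^ (k + 1) * ((ascPochhammer ℂ k).eval s / (k.factorial : ℂ))

/-- The explicit coefficient
`γ + log 2 + ∑_{k=1}^m C(m,k) (-2)^k ζ(k+1) + (-1)^(m+1) + ∑_{k=1}^m 1/k`. -/
noncomputable def z (m : ℕ) : ℂ :=
  (Real.eulerMascheroniConstant : ℂ) + (Real.log 2 : ℂ)
    + ∑ k ∈ Finset.Icc 1 m, (m.choose k : ℂ) * (-2) ^ k * riemannZeta ((k : ℂ) + 1)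
    + (-1) ^ (m + 1)
    + ∑ k ∈ Finset.Icc 1 m, 1 / (k : ℂ)

/-- The space `𝓔^α` of analytic functions on `{Re z > 0}` for which there are `a < α` and `b > 0`
such that for every `ε > 0` there is `C` with `|f(z)| ≤ C e^{b Re z} e^{a |Im z|}` on
`{Re z > ε}`. -/
def MemE (α : ℝ) (f : ℂ → ℂ) : Prop :=
  DifferentiableOn ℂ f {w : ℂ | 0 < w.re} ∧
    ∃ a b : ℝ, a < α ∧ 0 < b ∧ ∀ ε : ℝ, 0 < ε → ∃ C : ℝ, ∀ w : ℂ, ε < w.re →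
      ‖f w‖ ≤ C * Real.exp (b * w.re) * Real.exp (a * |w.im|)

/-- The integrand `(f(1+it) - f(1-it)) / (e^{2πt} - 1)` in the definition of Ramanujan summation. -/
noncomputable def planaIntegrand (f : ℂ → ℂ) (t : ℝ) : ℂ :=
  (f (1 + Complex.I * t) - f (1 - Complex.I * t)) / ((Real.exp (2 * Real.pi * t) - 1 : ℝ) : ℂ)

/-- `f ∈ 𝓔^π` and the Ramanujan summation of the series `∑_{n ≥ 1} f(n)`, namely
`f(1)/2 + i ∫_0^∞ (f(1+it) - f(1-it)) / (e^{2πt} - 1) dt` (a convergent integral), equals `S`. -/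
def HasRamanujanSum (f : ℂ → ℂ) (S : ℂ) : Prop :=
  MemE Real.pi f ∧
    MeasureTheory.IntegrableOn (planaIntegrand f) (Set.Ioi 0) ∧
    f 1 / 2 + Complex.I * ∫ t in Set.Ioi (0 : ℝ), planaIntegrand f t = S

end ZetaStrip

/-!
Every `f` which is a Laplace transform, `f w = ∫₀^∞ g(u) e^(-wu) du`, has the Ramanujan sum
`∫₀^∞ g(u) e^(-u) (1 / (1 - e^(-u)) - 1 / u) du`: exchange the Plana integral with the Laplace
integral and use Legendre's integral for `∫₀^∞ sin(ut) / (e^(2πt) - 1) dt`, which is the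
Mittag-Leffler expansion of the cotangent (`integral_sin_div_exp_sub_one`). Applied to the powers
`(w + c - 1)^(-s)` this gives a Mellin transform (`plana_cpow`). For `c = 1` it equals
`ζ(s) - 1 / (s - 1)` on `Re s > 0`, by a geometric series when `Re s > 1` and by analytic
continuation in general (`mellin_ramanujanKernel_one`); the case `c = 2` differs from it by
elementary integrals (`mellin_ramanujanKernel_two`, and `mellin_ramanujanKernel_two_one` at the
removable singularity `s = 1`).

Expanding `((w - 1) / (w + 1))^m / (w + 1)` by the binomial theorem in the powers
`(w + 1)^(-k - 1)` then yields the values `z m` (`plana_mobiusTerm`).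

The polynomials satisfy the recurrence `(m + 1) P (m + 1) = (1 - 2s) P m + m P (m - 1)`. Hence they
grow at most polynomially in `m`, and their generating function solves a first-order differential
equation, which gives `w^(-s) = ∑ m, P m s * ((w - 1) / (w + 1))^m / (w + 1)` on `Re w > 0`
(`hasSum_P_mul`). Summing both sides in the sense of Ramanujan gives the series for `ζ`. The
exchange of the sum with the Plana integral is justified because
`|(w - 1) / (w + 1)|^m = (t / √(4 + t²))^m` on the line `w = 1 ± it`: against `e^(-πt)` this decays
faster than any power of `m` (`exists_norm_planaIntegrand_le`).
-/

open Complex MeasureTheory Set Filter Topology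

namespace ZetaStrip

/-! ### The Laplace transform of a power -/

lemma integrableOn_rpow_mul_exp_neg {σ c : ℝ} (hσ : 0 < σ) (hc : 0 < c) :
    IntegrableOn (fun u : ℝ => u ^ (σ - 1) * Real.exp (-(c * u))) (Ioi 0) := by
  have := integrableOn_rpow_mul_exp_neg_mul_rpow (s := σ - 1) (p := 1) (b := c)
    (by linarith) one_pos hc
  simpa [neg_mul] using this

lemma norm_cpow_mul_exp (s p : ℂ) {u : ℝ} (hu : 0 < u) :
    ‖(u : ℂ) ^ (s - 1) * cexp (-(p * u))‖ = u ^ (s.re - 1) * Real.exp (-(p.re * u)) := by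
  rw [norm_mul, norm_cpow_eq_rpow_re_of_pos hu, Complex.norm_exp]
  simp

lemma continuousOn_ofReal_cpow (s : ℂ) : ContinuousOn (fun u : ℝ => (u : ℂ) ^ s) (Ioi 0) :=
  continuousOn_of_forall_continuousAt fun _ hu =>
    continuousAt_ofReal_cpow_const _ _ (Or.inr (ne_of_gt hu))

lemma aestronglyMeasurable_cpow_mul_exp (s p : ℂ) :
    AEStronglyMeasurable (fun u : ℝ => (u : ℂ) ^ (s - 1) * cexp (-(p * u)))
      (volume.restrict (Ioi 0)) :=
  ((continuousOn_ofReal_cpow _).mul (by fun_prop)).aestronglyMeasurable measurableSet_Ioi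

lemma integrableOn_cpow_mul_exp {s p : ℂ} (hs : 0 < s.re) (hp : 0 < p.re) :
    IntegrableOn (fun u : ℝ => (u : ℂ) ^ (s - 1) * cexp (-(p * u))) (Ioi 0) := by
  refine (integrableOn_rpow_mul_exp_neg hs hp).mono' (aestronglyMeasurable_cpow_mul_exp s p) ?_
  filter_upwards [ae_restrict_mem measurableSet_Ioi] with u hu
  exact (norm_cpow_mul_exp s p hu).le

lemma differentiableAt_integral_cpow_mul_exp {s p : ℂ} (hs : 0 < s.re) (hp : 0 < p.re) :
    DifferentiableAt ℂ
      (fun q : ℂ => ∫ u in Ioi (0 : ℝ), (u : ℂ) ^ (s - 1) * cexp (-(q * u))) p := by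
  have hball : Metric.ball p (p.re / 2) ∈ 𝓝 p := Metric.ball_mem_nhds _ (by positivity)
  refine (hasDerivAt_integral_of_dominated_loc_of_deriv_le
    (F' := fun (q : ℂ) (u : ℝ) => (u : ℂ) ^ (s - 1) * (cexp (-(q * u)) * (-(u : ℂ))))
    (bound := fun u : ℝ => u ^ (s.re + 1 - 1) * Real.exp (-(p.re / 2 * u))) hball
    (Eventually.of_forall fun q => aestronglyMeasurable_cpow_mul_exp s q)
    (integrableOn_cpow_mul_exp hs hp) ?_ ?_
    (integrableOn_rpow_mul_exp_neg (by linarith) (by linarith)) ?_).2.differentiableAt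
  · exact ((continuousOn_ofReal_cpow _).mul (by fun_prop)).aestronglyMeasurable measurableSet_Ioi
  · filter_upwards [ae_restrict_mem measurableSet_Ioi] with u hu q hq
    have hu : 0 < u := hu
    have hq' : p.re / 2 ≤ q.re := by
      have h1 := (abs_re_le_norm (q - p)).trans (mem_ball_iff_norm.1 hq).le
      rw [sub_re] at h1
      linarith [(abs_le.1 h1).1]
    rw [← mul_assoc, norm_mul, norm_cpow_mul_exp s q hu, norm_neg, norm_real,
      Real.norm_of_nonneg hu.le, mul_right_comm, ← Real.rpow_add_one hu.ne']
    ring_nf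
    gcongr
    nlinarith
  · refine Eventually.of_forall fun u q _ => ?_
    have h1 : HasDerivAt (fun q : ℂ => -(q * u)) (-(u : ℂ)) q := by
      simpa using ((hasDerivAt_id' q).mul_const (u : ℂ)).fun_neg
    exact h1.cexp.const_mul _

lemma isOpen_re_pos : IsOpen {w : ℂ | 0 < w.re} := isOpen_lt continuous_const continuous_re

lemma isPreconnected_re_pos : IsPreconnected {w : ℂ | 0 < w.re} :=
  (convex_halfSpace_re_gt 0).isPreconnected

/-- Euler's integral with a complex rate `p`. Both sides are analytic in `p`, and the case of
positive real `p` is in Mathlib. -/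
lemma integral_cpow_mul_exp {s p : ℂ} (hs : 0 < s.re) (hp : 0 < p.re) :
    ∫ u in Ioi (0 : ℝ), (u : ℂ) ^ (s - 1) * cexp (-(p * u)) = p ^ (-s) * Gamma s := by
  have h1 : AnalyticOnNhd ℂ
      (fun q : ℂ => ∫ u in Ioi (0 : ℝ), (u : ℂ) ^ (s - 1) * cexp (-(q * u))) {w : ℂ | 0 < w.re} :=
    DifferentiableOn.analyticOnNhd (fun q hq =>
      (differentiableAt_integral_cpow_mul_exp hs hq).differentiableWithinAt) isOpen_re_pos
  have h2 : AnalyticOnNhd ℂ (fun q : ℂ => q ^ (-s) * Gamma s) {w : ℂ | 0 < w.re} :=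
    DifferentiableOn.analyticOnNhd (fun q hq => by
      have : q ∈ slitPlane := Or.inl hq
      exact ((differentiableAt_id.cpow (differentiableAt_const _) this).mul_const
        _).differentiableWithinAt) isOpen_re_pos
  refine h1.eqOn_of_preconnected_of_frequently_eq h2 isPreconnected_re_pos
    (z₀ := (1 : ℂ)) (by simp) ?_ hp
  have hreal : ∀ r : ℝ, 0 < r →
      ∫ u in Ioi (0 : ℝ), (u : ℂ) ^ (s - 1) * cexp (-((r : ℂ) * u)) = (r : ℂ) ^ (-s) * Gamma s := by
    intro r hr
    rw [Complex.integral_cpow_mul_exp_neg_mul_Ioi hs hr, one_div, inv_cpow _ _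
      (by rw [arg_ofReal_of_nonneg hr.le]; exact Real.pi_pos.ne), cpow_neg]
  have ht : Tendsto (fun r : ℝ => (r : ℂ)) (𝓝[≠] 1) (𝓝[≠] 1) := by
    refine tendsto_nhdsWithin_iff.2 ⟨?_, ?_⟩
    · exact ((continuous_ofReal.tendsto 1).mono_left nhdsWithin_le_nhds)
    · filter_upwards [self_mem_nhdsWithin] with r hr
      simpa using hr
  refine ht.frequently (Eventually.frequently ?_)
  filter_upwards [nhdsWithin_le_nhds (lt_mem_nhds (zero_lt_one' ℝ))] with r hr
  exact hreal r hr

/-! ### The sine transform of `1 / (e^(2πt) - 1)` -/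

lemma one_div_exp_two_pi_sub_one_le {t : ℝ} (ht : 0 < t) :
    1 / (Real.exp (2 * Real.pi * t) - 1) ≤ Real.exp (-(Real.pi * t)) / (2 * Real.pi * t) := by
  have hy : 0 < Real.pi * t := by positivity
  have h1 := Real.self_le_sinh_iff.2 hy.le
  rw [Real.sinh_eq] at h1
  have h2 : Real.exp (2 * Real.pi * t) - 1 =
      Real.exp (Real.pi * t) * (Real.exp (Real.pi * t) - Real.exp (-(Real.pi * t))) := by
    rw [mul_sub, ← Real.exp_add, ← Real.exp_add, add_neg_cancel, Real.exp_zero]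
    ring_nf
  have h3 : Real.exp (-(Real.pi * t)) / (2 * Real.pi * t)
      = 1 / (Real.exp (Real.pi * t) * (2 * Real.pi * t)) := by
    rw [Real.exp_neg]
    field_simp
  rw [h2, h3]
  apply one_div_le_one_div_of_le (by positivity)
  gcongr
  linarith

lemma exp_two_pi_sub_one_pos {t : ℝ} (ht : 0 < t) : 0 < Real.exp (2 * Real.pi * t) - 1 := by
  have : 0 < 2 * Real.pi * t := by positivity
  linarith [Real.add_one_lt_exp this.ne']

lemma div_exp_two_pi_sub_one_le {t : ℝ} (ht : 0 < t) :
    t / (Real.exp (2 * Real.pi * t) - 1) ≤ Real.exp (-(Real.pi * t)) := by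
  have h := mul_le_mul_of_nonneg_left (one_div_exp_two_pi_sub_one_le ht) ht.le
  have h2 : t * (Real.exp (-(Real.pi * t)) / (2 * Real.pi * t)) =
      Real.exp (-(Real.pi * t)) / (2 * Real.pi) := by
    field_simp
  rw [h2, mul_one_div] at h
  refine h.trans (div_le_self (Real.exp_pos _).le ?_)
  linarith [Real.pi_gt_three]

lemma integrableOn_exp_neg_mul {a : ℝ} (ha : 0 < a) :
    IntegrableOn (fun t : ℝ => Real.exp (-(a * t))) (Ioi 0) := by
  simpa using integrableOn_rpow_mul_exp_neg (σ := 1) one_pos ha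

lemma integrableOn_exp_neg_mul_mul_sin {a : ℝ} (ha : 0 < a) (u : ℝ) :
    IntegrableOn (fun t : ℝ => Real.exp (-(a * t)) * Real.sin (u * t)) (Ioi 0) := by
  refine (integrableOn_exp_neg_mul ha).mono' (by fun_prop) (Eventually.of_forall fun t => ?_)
  rw [norm_mul, Real.norm_of_nonneg (Real.exp_pos _).le]
  exact mul_le_of_le_one_right (Real.exp_pos _).le (Real.abs_sin_le_one _)

lemma integral_exp_neg_mul_mul_sin {a : ℝ} (ha : 0 < a) (u : ℝ) :
    ∫ t in Ioi (0 : ℝ), Real.exp (-(a * t)) * Real.sin (u * t) = u / (a ^ 2 + u ^ 2) := by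
  have hre : (-(a : ℂ) + u * I).re < 0 := by simpa using ha
  have h := integral_exp_mul_complex_Ioi hre 0
  have hint := integrableOn_exp_mul_complex_Ioi hre 0
  have h2 : ∀ t : ℝ, Real.exp (-(a * t)) * Real.sin (u * t)
      = RCLike.im (cexp ((-(a : ℂ) + u * I) * t)) := by
    intro t
    rw [RCLike.im_to_complex, Complex.exp_im]
    simp
  simp_rw [h2]
  rw [integral_im hint, h, RCLike.im_to_complex]
  simp [Complex.div_im, normSq_apply]
  ring

lemma hasSum_exp_neg_two_pi {t : ℝ} (ht : 0 < t) :
    HasSum (fun n : ℕ => Real.exp (-(2 * Real.pi * (n + 1) * t)))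
      (1 / (Real.exp (2 * Real.pi * t) - 1)) := by
  have hpos : 0 < 2 * Real.pi * t := by positivity
  have hr : Real.exp (-(2 * Real.pi * t)) < 1 := Real.exp_lt_one_iff.2 (by linarith)
  have h := (hasSum_geometric_of_lt_one (Real.exp_pos _).le hr).mul_left
    (Real.exp (-(2 * Real.pi * t)))
  convert! h using 1
  · ext n
    rw [← Real.exp_nat_mul, ← Real.exp_add]
    ring_nf
  · have := exp_two_pi_sub_one_pos ht
    have h3 : 1 - Real.exp (-(2 * Real.pi * t)) ≠ 0 := by linarith
    rw [Real.exp_neg] at h3 ⊢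
    field_simp

/-- The Mittag-Leffler expansion of the cotangent, on the imaginary axis. -/
lemma tsum_div_sq_add_sq {u : ℝ} (hu : 0 < u) :
    ∑' n : ℕ, u / ((2 * Real.pi * (n + 1)) ^ 2 + u ^ 2)
      = (1 / (1 - Real.exp (-u)) - 1 / u - 1 / 2) / 2 := by
  set x : ℂ := u / (2 * Real.pi) * I with hx
  have hpi : (Real.pi : ℂ) ≠ 0 := by exact_mod_cast Real.pi_ne_zero
  have huc : (u : ℂ) ≠ 0 := by exact_mod_cast hu.ne'
  have him : 0 < x.im := by
    have : x = ((u / (2 * Real.pi) : ℝ) : ℂ) * I := by rw [hx]; push_cast; ring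
    rw [this]
    simp only [mul_im, ofReal_re, I_im, ofReal_im, I_re]
    simp only [mul_one, mul_zero, add_zero]
    positivity
  have hxZ : x ∈ Complex.integerComplement :=
    UpperHalfPlane.coe_mem_integerComplement ⟨x, him⟩
  have h := cot_series_rep' hxZ
  rw [Complex.cot_pi_eq_exp_ratio] at h
  have hexp : cexp (2 * Real.pi * I * x) = (Real.exp (-u) : ℝ) := by
    rw [hx]
    push_cast
    congr 1
    field_simp
    rw [I_sq]
  have hlt : Real.exp (-u) < 1 := Real.exp_lt_one_iff.2 (by linarith)
  have hE : (1 - (Real.exp (-u) : ℂ)) ≠ 0 := by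
    have : (1 - Real.exp (-u)) ≠ 0 := by linarith
    exact_mod_cast this
  have hterm : ∀ n : ℕ, (1 / (x - (n + 1)) + 1 / (x + (n + 1)))
      = (-(4 * Real.pi * I)) * ((u / ((2 * Real.pi * (n + 1)) ^ 2 + u ^ 2) : ℝ) : ℂ) := by
    intro n
    have h1 : x + ((n + 1 : ℤ) : ℂ) ≠ 0 := integerComplement_add_ne_zero hxZ _
    have h2 : x + ((-(n + 1) : ℤ) : ℂ) ≠ 0 := integerComplement_add_ne_zero hxZ _
    have h1' : x + ((n : ℂ) + 1) ≠ 0 := by simpa using h1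
    have h2' : x - ((n : ℂ) + 1) ≠ 0 := by
      convert! h2 using 1
      push_cast
      ring
    have h3 : ((2 * Real.pi * (n + 1)) ^ 2 + u ^ 2 : ℂ) ≠ 0 := by
      have : ((2 * Real.pi * (n + 1)) ^ 2 + u ^ 2 : ℝ) ≠ 0 := by positivity
      exact_mod_cast this
    have h4 : (x - (n + 1)) * (x + (n + 1)) * (4 * Real.pi ^ 2)
        = -((2 * Real.pi * (n + 1)) ^ 2 + u ^ 2) := by
      have : x * (2 * Real.pi) = u * I := by rw [hx]; field_simp
      linear_combination (x * (2 * Real.pi) + u * I) * this + u ^ 2 * I_sq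
    have h5 : x * (2 * Real.pi) = u * I := by rw [hx]; field_simp
    push_cast
    rw [div_add_div _ _ h2' h1', mul_div_assoc', div_eq_div_iff (mul_ne_zero h2' h1') h3]
    have h6 : (4 * (Real.pi : ℂ) ^ 2) ≠ 0 := by simp [hpi]
    apply mul_right_cancel₀ h6
    linear_combination (4 * Real.pi * I * u) * h4 +
      (4 * Real.pi * ((2 * Real.pi * (n + 1)) ^ 2 + u ^ 2)) * h5
  simp_rw [hterm] at h
  rw [tsum_mul_left, ← ofReal_tsum, hexp] at h
  apply ofReal_injective
  have h7 : (-(4 * Real.pi * I) : ℂ) ≠ 0 := by simp [hpi]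
  apply mul_left_cancel₀ h7
  rw [← h, hx]
  push_cast at hE ⊢
  field_simp
  simp only [I_sq]
  ring

/-- **Legendre's integral** `∫₀^∞ sin(ut) / (e^(2πt) - 1) dt`, by expanding the kernel into a
geometric series. -/
lemma integral_sin_div_exp_sub_one {u : ℝ} (hu : 0 < u) :
    ∫ t in Ioi (0 : ℝ), Real.sin (u * t) / (Real.exp (2 * Real.pi * t) - 1)
      = (1 / (1 - Real.exp (-u)) - 1 / u - 1 / 2) / 2 := by
  have hpos : ∀ n : ℕ, 0 < 2 * Real.pi * (n + 1) := fun n => by positivity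
  have hsum := hasSum_integral_of_summable_integral_norm
    (μ := volume.restrict (Ioi (0 : ℝ)))
    (F := fun (n : ℕ) (t : ℝ) => Real.exp (-(2 * Real.pi * (n + 1) * t)) * Real.sin (u * t))
    (fun n => integrableOn_exp_neg_mul_mul_sin (hpos n) u) ?_
  · rw [← tsum_div_sq_add_sq hu, ← funext fun n : ℕ => integral_exp_neg_mul_mul_sin (hpos n) u,
      hsum.tsum_eq]
    refine setIntegral_congr_fun measurableSet_Ioi fun t ht => ?_
    change _ = ∑' n : ℕ, Real.exp (-(2 * Real.pi * (n + 1) * t)) * Real.sin (u * t)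
    rw [tsum_mul_right, (hasSum_exp_neg_two_pi ht).tsum_eq]
    ring
  · -- `|sin (u t)| ≤ u t` makes the `n`-th integral `O(1 / n ^ 2)`
    have hs : Summable fun n : ℕ => u * (1 / (2 * Real.pi * (n + 1)) ^ 2) := by
      have h1 := (summable_nat_add_iff 1).2 (Real.summable_one_div_nat_pow.2 (one_lt_two))
      refine (h1.mul_left (u / (2 * Real.pi) ^ 2)).congr fun n => ?_
      push_cast
      field_simp
    refine Summable.of_nonneg_of_le (fun n => by positivity) (fun n => ?_) hs
    have h2 : ∫ t in Ioi (0 : ℝ), t ^ ((2 : ℝ) - 1) * Real.exp (-(2 * Real.pi * (n + 1) * t))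
        = 1 / (2 * Real.pi * (n + 1)) ^ 2 := by
      rw [Real.integral_rpow_mul_exp_neg_mul_Ioi two_pos (hpos n), Real.Gamma_two, mul_one,
        Real.rpow_two, div_pow, one_pow]
    rw [← h2, ← integral_const_mul]
    refine setIntegral_mono_on (integrableOn_exp_neg_mul_mul_sin (hpos n) u).norm
      ((integrableOn_rpow_mul_exp_neg two_pos (hpos n)).const_mul u) measurableSet_Ioi
      fun t ht => ?_
    have ht : 0 < t := ht
    rw [norm_mul, Real.norm_of_nonneg (Real.exp_pos _).le, Real.norm_eq_abs]
    have h3 : |Real.sin (u * t)| ≤ u * t :=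
      Real.abs_sin_le_abs.trans_eq (abs_of_pos (by positivity))
    norm_num
    nlinarith [Real.exp_pos (-(2 * Real.pi * (n + 1) * t))]

/-! ### Ramanujan summation of powers as a Mellin transform -/

/-- The function `e^(-cu) (1 / (1 - e^(-u)) - 1 / u)` of `u`. Its Mellin transform at `s` is
`Γ(s)` times the Ramanujan sum of `(n + c - 1)^(-s)`. -/
noncomputable def ramanujanKernel (c u : ℝ) : ℝ :=
  Real.exp (-(c * u)) * (1 / (1 - Real.exp (-u)) - 1 / u)

lemma one_sub_exp_neg_pos {u : ℝ} (hu : 0 < u) : 0 < 1 - Real.exp (-u) := by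
  have : Real.exp (-u) < 1 := Real.exp_lt_one_iff.2 (by linarith)
  linarith

/-- The factor `1 / (1 - e^(-u)) - 1 / u` lies between `0` and `1`. -/
lemma abs_ramanujanKernel_le (c : ℝ) {u : ℝ} (hu : 0 < u) :
    |ramanujanKernel c u| ≤ Real.exp (-(c * u)) := by
  have h0 := one_sub_exp_neg_pos hu
  have h1 : 1 / u ≤ 1 / (1 - Real.exp (-u)) :=
    one_div_le_one_div_of_le h0 (by linarith [Real.add_one_le_exp (-u)])
  have h2 : 1 / (1 - Real.exp (-u)) ≤ 1 + 1 / u := by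
    have h3 : (1 + u) * Real.exp (-u) ≤ 1 := by
      rw [Real.exp_neg, ← div_eq_mul_inv, div_le_one (Real.exp_pos _)]
      linarith [Real.add_one_le_exp u]
    rw [div_le_iff₀ h0]
    have h4 : (1 + 1 / u) * (1 - Real.exp (-u)) - 1 = (1 - (1 + u) * Real.exp (-u)) / u := by
      field_simp
      ring
    have h5 : 0 ≤ (1 - (1 + u) * Real.exp (-u)) / u := div_nonneg (by linarith) hu.le
    linarith
  rw [ramanujanKernel, abs_mul, abs_of_pos (Real.exp_pos _)]
  refine mul_le_of_le_one_right (Real.exp_pos _).le (abs_le.2 ⟨by linarith, by linarith⟩)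

lemma continuousOn_ramanujanKernel (c : ℝ) :
    ContinuousOn (fun u => (ramanujanKernel c u : ℂ)) (Ioi 0) := by
  refine continuous_ofReal.comp_continuousOn ?_
  unfold ramanujanKernel
  refine ContinuousOn.mul (by fun_prop) (ContinuousOn.sub ?_ ?_)
  · exact continuousOn_const.div (by fun_prop) fun u hu => (one_sub_exp_neg_pos hu).ne'
  · exact continuousOn_const.div (by fun_prop) fun u hu => ne_of_gt hu

lemma mellinConvergent_ramanujanKernel {c : ℝ} (hc : 0 < c) {s : ℂ} (hs : 0 < s.re) :
    MellinConvergent (fun u => (ramanujanKernel c u : ℂ)) s := by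
  refine (integrableOn_rpow_mul_exp_neg hs hc).mono' (((continuousOn_ofReal_cpow _).smul
    (continuousOn_ramanujanKernel c)).aestronglyMeasurable measurableSet_Ioi) ?_
  filter_upwards [ae_restrict_mem measurableSet_Ioi] with u hu
  have hu : 0 < u := hu
  rw [norm_smul, norm_cpow_eq_rpow_re_of_pos hu, norm_real, sub_re, one_re]
  gcongr
  exact abs_ramanujanKernel_le c hu

lemma differentiableAt_mellin_ramanujanKernel {c : ℝ} (hc : 0 < c) {s : ℂ} (hs : 0 < s.re) :
    DifferentiableAt ℂ (mellin fun u => (ramanujanKernel c u : ℂ)) s := by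
  refine mellin_differentiableAt_of_isBigO_rpow_exp hc (b := 0)
    ((continuousOn_ramanujanKernel c).locallyIntegrableOn measurableSet_Ioi) ?_ ?_ hs
  · refine Asymptotics.IsBigO.of_bound 1 ?_
    filter_upwards [eventually_gt_atTop 0] with u hu
    simpa using abs_ramanujanKernel_le c hu
  · refine Asymptotics.IsBigO.of_bound 1 ?_
    filter_upwards [self_mem_nhdsWithin] with u hu
    have hu : 0 < u := hu
    have h1 : Real.exp (-(c * u)) ≤ 1 := Real.exp_le_one_iff.2 (by
      have := mul_pos hc hu
      linarith)
    simpa using (abs_ramanujanKernel_le c hu).trans h1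

/-- Absolute convergence of the double integral behind the Plana integral of a power: the factor
`1 / (e^(2πt) - 1)`, singular at `t = 0`, is tamed by `|sin (ut)| ≤ ut`. -/
lemma integrable_cpow_mul_exp_mul_sin_div {s : ℂ} (hs : 0 < s.re) {c : ℝ} (hc : 0 < c) :
    Integrable (Function.uncurry fun t u : ℝ => (u : ℂ) ^ (s - 1) * cexp (-(c * u)) *
      ((Real.sin (u * t) / (Real.exp (2 * Real.pi * t) - 1) : ℝ) : ℂ))
      ((volume.restrict (Ioi 0)).prod (volume.restrict (Ioi 0))) := by
  have hdom := (integrableOn_exp_neg_mul Real.pi_pos).mul_prod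
    (integrableOn_rpow_mul_exp_neg (σ := s.re + 1) (by linarith) hc)
  have hmem : ∀ᵐ z : ℝ × ℝ ∂((volume.restrict (Ioi (0 : ℝ))).prod (volume.restrict (Ioi 0))),
      z ∈ Ioi (0 : ℝ) ×ˢ Ioi (0 : ℝ) := by
    rw [Measure.prod_restrict]
    exact ae_restrict_mem (measurableSet_Ioi.prod measurableSet_Ioi)
  refine hdom.mono' ?_ ?_
  · rw [Measure.prod_restrict]
    refine ContinuousOn.aestronglyMeasurable ?_ (measurableSet_Ioi.prod measurableSet_Ioi)
    refine ContinuousOn.mul (ContinuousOn.mul ?_ (by fun_prop)) ?_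
    · exact (continuousOn_ofReal_cpow (s - 1)).comp continuousOn_snd fun z hz => hz.2
    · refine continuous_ofReal.comp_continuousOn (ContinuousOn.div (by fun_prop) (by fun_prop) ?_)
      exact fun z hz => (exp_two_pi_sub_one_pos hz.1).ne'
  · filter_upwards [hmem] with z hz
    obtain ⟨t, u⟩ := z
    have ht : 0 < t := hz.1
    have hu : 0 < u := hz.2
    simp only [Function.uncurry]
    rw [norm_mul, norm_cpow_mul_exp _ _ hu, norm_real, ofReal_re, Real.norm_eq_abs, abs_div,
      abs_of_pos (exp_two_pi_sub_one_pos ht)]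
    have h1 : |Real.sin (u * t)| ≤ u * t :=
      Real.abs_sin_le_abs.trans_eq (abs_of_pos (by positivity))
    have hE := exp_two_pi_sub_one_pos ht
    calc u ^ (s.re - 1) * Real.exp (-(c * u)) *
          (|Real.sin (u * t)| / (Real.exp (2 * Real.pi * t) - 1))
        ≤ u ^ (s.re - 1) * Real.exp (-(c * u)) *
          (u * t / (Real.exp (2 * Real.pi * t) - 1)) := by gcongr
      _ = (t / (Real.exp (2 * Real.pi * t) - 1)) *
          (u ^ (s.re - 1 + 1) * Real.exp (-(c * u))) := by
        rw [Real.rpow_add_one hu.ne']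
        ring
      _ ≤ Real.exp (-(Real.pi * t)) * (u ^ (s.re + 1 - 1) * Real.exp (-(c * u))) := by
        rw [show s.re - 1 + 1 = s.re + 1 - 1 by ring]
        gcongr
        exact div_exp_two_pi_sub_one_le ht

lemma integral_cpow_mul_exp_mul_sin_div {s : ℂ} (hs : 0 < s.re) {c : ℝ} (hc : 0 < c) (t : ℝ) :
    ∫ u in Ioi (0 : ℝ), (u : ℂ) ^ (s - 1) * cexp (-(c * u)) *
      ((Real.sin (u * t) / (Real.exp (2 * Real.pi * t) - 1) : ℝ) : ℂ)
      = I / 2 * Gamma s * planaIntegrand (fun w => (w + (c - 1 : ℝ)) ^ (-s)) t := by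
  have hp : 0 < (c + I * t : ℂ).re := by simpa using hc
  have hm : 0 < (c - I * t : ℂ).re := by simpa using hc
  have h1 := integral_cpow_mul_exp hs hp
  have h2 := integral_cpow_mul_exp hs hm
  have e1 : (1 + I * t + (c - 1 : ℝ) : ℂ) = c + I * t := by push_cast; ring
  have e2 : (1 - I * t + (c - 1 : ℝ) : ℂ) = c - I * t := by push_cast; ring
  have h3 : ∀ u : ℝ, (u : ℂ) ^ (s - 1) * cexp (-(c * u)) *
      ((Real.sin (u * t) / (Real.exp (2 * Real.pi * t) - 1) : ℝ) : ℂ)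
      = I / 2 / ((Real.exp (2 * Real.pi * t) - 1 : ℝ) : ℂ) *
        ((u : ℂ) ^ (s - 1) * cexp (-((c + I * t) * u))
          - (u : ℂ) ^ (s - 1) * cexp (-((c - I * t) * u))) := by
    intro u
    have e3 : cexp (-((c + I * t) * u)) = cexp (-(c * u)) * cexp (-(u * t) * I) := by
      rw [← Complex.exp_add]; ring_nf
    have e4 : cexp (-((c - I * t) * u)) = cexp (-(c * u)) * cexp ((u * t) * I) := by
      rw [← Complex.exp_add]; ring_nf
    rw [e3, e4, ofReal_div, ofReal_sin, Complex.sin]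
    push_cast
    ring
  simp_rw [h3]
  rw [integral_const_mul, integral_sub (integrableOn_cpow_mul_exp hs hp)
    (integrableOn_cpow_mul_exp hs hm), h1, h2, planaIntegrand, e1, e2]
  ring

/-- The Ramanujan sum of `(n + c - 1)^(-s)`, with the convergence of its Plana integral: write the
powers as Laplace transforms, exchange the integrals and apply Legendre's integral. -/
lemma plana_cpow {s : ℂ} (hs : 0 < s.re) {c : ℝ} (hc : 0 < c) :
    IntegrableOn (planaIntegrand fun w => (w + (c - 1 : ℝ)) ^ (-s)) (Ioi 0) ∧
    (c : ℂ) ^ (-s) / 2 +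
      I * ∫ t in Ioi (0 : ℝ), planaIntegrand (fun w => (w + (c - 1 : ℝ)) ^ (-s)) t
      = mellin (fun u => (ramanujanKernel c u : ℂ)) s / Gamma s := by
  have hG : Gamma s ≠ 0 := Gamma_ne_zero_of_re_pos hs
  have hint := integrable_cpow_mul_exp_mul_sin_div hs hc
  have hI2 : I / 2 * Gamma s ≠ 0 := by simp [hG]
  have h1 := hint.integral_prod_left
  simp only [Function.uncurry, integral_cpow_mul_exp_mul_sin_div hs hc] at h1
  have h2 := integral_integral_swap hint
  simp only [integral_cpow_mul_exp_mul_sin_div hs hc] at h2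
  have hcs : 0 < (c : ℂ).re := hc
  have h3 : ∫ u in Ioi (0 : ℝ), ∫ t in Ioi (0 : ℝ), (u : ℂ) ^ (s - 1) * cexp (-(c * u)) *
      ((Real.sin (u * t) / (Real.exp (2 * Real.pi * t) - 1) : ℝ) : ℂ)
      = ∫ u in Ioi (0 : ℝ), ((u : ℂ) ^ (s - 1) • (ramanujanKernel c u : ℂ)
        - 1 / 2 * ((u : ℂ) ^ (s - 1) * cexp (-(c * u)))) / 2 := by
    refine setIntegral_congr_fun measurableSet_Ioi fun u hu => ?_
    rw [integral_const_mul, integral_complex_ofReal, integral_sin_div_exp_sub_one hu, ramanujanKernel,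
      smul_eq_mul]
    push_cast
    ring
  rw [h3, integral_const_mul, integral_div, integral_sub
    (mellinConvergent_ramanujanKernel hc hs)
    ((integrableOn_cpow_mul_exp hs hcs).const_mul _), integral_const_mul,
    integral_cpow_mul_exp hs hcs] at h2
  refine ⟨(integrable_const_mul_iff (Ne.isUnit hI2) _).1 h1, ?_⟩
  rw [mellin, eq_div_iff hG]
  linear_combination 2 * h2

/-! ### Comparison with the zeta function -/

lemma hasMellin_exp_neg_div {c : ℝ} (hc : 0 < c) {s : ℂ} (hs : 1 < s.re) :
    HasMellin (fun u => ((Real.exp (-(c * u)) / u : ℝ) : ℂ)) s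
      ((c : ℂ) ^ (1 - s) * Gamma (s - 1)) := by
  have h0 : 0 < (s - 1).re := by simpa using hs
  have hcs : 0 < (c : ℂ).re := hc
  have he : EqOn (fun u : ℝ => (u : ℂ) ^ (s - 1 - 1) * cexp (-(c * u)))
      (fun u : ℝ => (u : ℂ) ^ (s - 1) • ((Real.exp (-(c * u)) / u : ℝ) : ℂ)) (Ioi 0) := by
    intro u hu
    have hu' : (u : ℂ) ≠ 0 := ofReal_ne_zero.2 (ne_of_gt hu)
    simp only [smul_eq_mul]
    rw [cpow_sub (s - 1) 1 hu', cpow_one]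
    push_cast
    ring
  refine ⟨(integrableOn_cpow_mul_exp h0 hcs).congr_fun he measurableSet_Ioi, ?_⟩
  rw [mellin, ← setIntegral_congr_fun measurableSet_Ioi he, integral_cpow_mul_exp h0 hcs, neg_sub]

/-- The Mellin transform of `1 / (e^u - 1)`. -/
lemma mellin_bose {s : ℂ} (hs : 1 < s.re) :
    mellin (fun u => ((Real.exp (-u) / (1 - Real.exp (-u)) : ℝ) : ℂ)) s
      = Gamma s * riemannZeta s := by
  have h := hasSum_mellin (ι := ℕ) (a := fun _ => 1) (p := fun n => (n : ℝ) + 1)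
    (F := fun u => ((Real.exp (-u) / (1 - Real.exp (-u)) : ℝ) : ℂ)) (s := s)
    (fun n => Or.inr (by positivity)) (by linarith) ?_ ?_
  · rw [← h.tsum_eq, zeta_eq_tsum_one_div_nat_add_one_cpow hs, ← tsum_mul_left]
    refine tsum_congr fun n => ?_
    push_cast
    ring
  · intro u hu
    have hu : 0 < u := hu
    have hr : Real.exp (-u) < 1 := Real.exp_lt_one_iff.2 (by linarith)
    have hg := (hasSum_geometric_of_lt_one (Real.exp_pos _).le hr).mul_left (Real.exp (-u))
    convert! hasSum_ofReal.2 hg using 1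
    ext n
    rw [one_mul, ← Real.exp_nat_mul, ← Real.exp_add]
    ring_nf
  · have h1 := (summable_nat_add_iff 1).2 (Real.summable_one_div_nat_rpow.2 hs)
    simpa using h1

lemma mellin_ramanujanKernel_one_of_one_lt_re {s : ℂ} (hs : 1 < s.re) :
    mellin (fun u => (ramanujanKernel 1 u : ℂ)) s / Gamma s = riemannZeta s - 1 / (s - 1) := by
  have h0 : 0 < s.re := by linarith
  have hs1 : s - 1 ≠ 0 := fun h => by
    rw [sub_eq_zero.1 h] at hs
    simp at hs
  have hsum := hasMellin_add (mellinConvergent_ramanujanKernel one_pos h0)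
    (hasMellin_exp_neg_div one_pos hs).1
  have he : mellin (fun u => (ramanujanKernel 1 u : ℂ) + ((Real.exp (-(1 * u)) / u : ℝ) : ℂ)) s
      = mellin (fun u => ((Real.exp (-u) / (1 - Real.exp (-u)) : ℝ) : ℂ)) s := by
    congr 1
    ext u
    rw [ramanujanKernel, one_mul]
    push_cast
    ring
  have hG : Gamma s = (s - 1) * Gamma (s - 1) := by
    have := Gamma_add_one (s - 1) hs1
    rwa [sub_add_cancel] at this
  have hG1 : Gamma (s - 1) ≠ 0 := Gamma_ne_zero_of_re_pos (by simpa using hs)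
  have h := hsum.2
  rw [he, mellin_bose hs, (hasMellin_exp_neg_div one_pos hs).2, hG] at h
  rw [hG]
  rw [ofReal_one, one_cpow, one_mul] at h
  rw [div_eq_iff (mul_ne_zero hs1 hG1), sub_mul, one_div_mul_eq_div, mul_div_cancel_left₀ _ hs1]
  linear_combination -h

/-- `ζ(s) - 1 / (s - 1)` with its removable singularity at `s = 1` filled in by Euler's constant. -/
noncomputable def zetaRegular : ℂ → ℂ :=
  Function.update (fun s => riemannZeta s - 1 / (s - 1)) 1 Real.eulerMascheroniConstant

lemma zetaRegular_of_ne {s : ℂ} (hs : s ≠ 1) : zetaRegular s = riemannZeta s - 1 / (s - 1) :=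
  Function.update_of_ne hs _ _

lemma differentiable_zetaRegular : Differentiable ℂ zetaRegular := by
  have hne : ∀ s : ℂ, s ≠ 1 → DifferentiableAt ℂ zetaRegular s := by
    intro s hs
    have h1 : DifferentiableAt ℂ (fun s => riemannZeta s - 1 / (s - 1)) s :=
      (differentiableAt_riemannZeta hs).sub
        ((differentiableAt_const _).div (by fun_prop) (sub_ne_zero.2 hs))
    refine h1.congr_of_eventuallyEq ?_
    filter_upwards [isOpen_ne.mem_nhds hs] with w hw using zetaRegular_of_ne hw
  intro s
  rcases eq_or_ne s 1 with rfl | hs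
  · refine (analyticAt_of_differentiable_on_punctured_nhds_of_continuousAt ?_
      ?_).differentiableAt
    · filter_upwards [self_mem_nhdsWithin] with s hs using hne s hs
    · exact continuousAt_update_same.2 tendsto_riemannZeta_sub_one_div
  · exact hne s hs

lemma mellin_ramanujanKernel_one {s : ℂ} (hs : 0 < s.re) :
    mellin (fun u => (ramanujanKernel 1 u : ℂ)) s / Gamma s = zetaRegular s := by
  have h1 : AnalyticOnNhd ℂ (fun s => mellin (fun u => (ramanujanKernel 1 u : ℂ)) s / Gamma s)
      {w : ℂ | 0 < w.re} :=
    DifferentiableOn.analyticOnNhd (fun q hq => by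
      have hq : 0 < q.re := hq
      refine ((differentiableAt_mellin_ramanujanKernel one_pos hq).div
        (differentiableAt_Gamma q fun m hm => ?_)
        (Gamma_ne_zero_of_re_pos hq)).differentiableWithinAt
      rw [hm] at hq
      simp only [neg_re, natCast_re] at hq
      linarith [Nat.cast_nonneg (α := ℝ) m]) isOpen_re_pos
  refine h1.eqOn_of_preconnected_of_eventuallyEq
    (differentiable_zetaRegular.differentiableOn.analyticOnNhd isOpen_re_pos)
    isPreconnected_re_pos (z₀ := 2) (by simp) ?_ hs
  filter_upwards [(isOpen_lt continuous_const continuous_re).mem_nhds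
    (show (1 : ℝ) < (2 : ℂ).re by simp)] with w hw
  have hw1 : w ≠ 1 := by
    rintro rfl
    simp at hw
  rw [mellin_ramanujanKernel_one_of_one_lt_re hw, zetaRegular_of_ne hw1]

lemma mellin_ramanujanKernel_two {s : ℂ} (hs : 1 < s.re) :
    mellin (fun u => (ramanujanKernel 2 u : ℂ)) s / Gamma s
      = riemannZeta s - 1 / (s - 1) - 1 - (2 ^ (1 - s) - 1) / (s - 1) := by
  have h0 : 0 < s.re := by linarith
  have hs1 : s - 1 ≠ 0 := fun h => by
    rw [sub_eq_zero.1 h] at hs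
    simp at hs
  have hG : Gamma s = (s - 1) * Gamma (s - 1) := by
    have := Gamma_add_one (s - 1) hs1
    rwa [sub_add_cancel] at this
  have hG1 : Gamma (s - 1) ≠ 0 := Gamma_ne_zero_of_re_pos (by simpa using hs)
  have hexp : HasMellin (fun u => ((Real.exp (-u) : ℝ) : ℂ)) s (Gamma s) := by
    have h1 : 0 < (1 : ℂ).re := by simp
    have he : (fun u : ℝ => (u : ℂ) ^ (s - 1) • ((Real.exp (-u) : ℝ) : ℂ))
        = fun u : ℝ => (u : ℂ) ^ (s - 1) * cexp (-(1 * u)) := by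
      ext u
      simp
    refine ⟨?_, ?_⟩
    · rw [MellinConvergent, he]
      exact integrableOn_cpow_mul_exp h0 h1
    · rw [mellin, he, integral_cpow_mul_exp h0 h1, one_cpow, one_mul]
  have hA := hasMellin_sub (mellinConvergent_ramanujanKernel one_pos h0) hexp.1
  have hB := hasMellin_sub (hasMellin_exp_neg_div two_pos hs).1 (hasMellin_exp_neg_div one_pos hs).1
  have hC := hasMellin_sub hA.1 hB.1
  have he : mellin (fun u => (ramanujanKernel 2 u : ℂ)) s
      = mellin (fun u => ((ramanujanKernel 1 u : ℂ) - ((Real.exp (-u) : ℝ) : ℂ))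
        - (((Real.exp (-(2 * u)) / u : ℝ) : ℂ) - ((Real.exp (-(1 * u)) / u : ℝ) : ℂ))) s := by
    refine setIntegral_congr_fun measurableSet_Ioi fun u hu => ?_
    simp only
    congr 1
    norm_cast
    have hE := (one_sub_exp_neg_pos hu).ne'
    have h2 : Real.exp (-(2 * u)) = Real.exp (-u) * Real.exp (-u) := by
      rw [← Real.exp_add]
      ring_nf
    have hu' : u ≠ 0 := ne_of_gt hu
    rw [ramanujanKernel, ramanujanKernel, h2, one_mul]
    field_simp
    ring
  rw [he, hC.2, hA.2, hB.2, hexp.2, (hasMellin_exp_neg_div two_pos hs).2,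
    (hasMellin_exp_neg_div one_pos hs).2, sub_div, sub_div,
    mellin_ramanujanKernel_one_of_one_lt_re hs, div_self (Gamma_ne_zero_of_re_pos h0), hG]
  congr 1
  push_cast
  rw [one_cpow]
  field_simp

/-- The value at `s = 1`, as the limit of `mellin_ramanujanKernel_two` for `s ↓ 1`: the pole of `ζ`
cancels, and `(2^(1 - s) - 1) / (s - 1)` tends to the derivative `-log 2`. -/
lemma mellin_ramanujanKernel_two_one :
    mellin (fun u => (ramanujanKernel 2 u : ℂ)) 1
      = (Real.eulerMascheroniConstant : ℂ) - 1 + (Real.log 2 : ℂ) := by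
  have hof : Tendsto (fun r : ℝ => (r : ℂ)) (𝓝[>] 1) (𝓝[≠] 1) := by
    refine tendsto_nhdsWithin_iff.2 ⟨?_, ?_⟩
    · exact ((continuous_ofReal.tendsto 1).mono_left nhdsWithin_le_nhds)
    · filter_upwards [self_mem_nhdsWithin] with r hr
      simpa using (ne_of_gt hr : r ≠ 1)
  have h1re : 0 < (1 : ℂ).re := by simp
  have hcont : ContinuousAt
      (fun s => mellin (fun u => (ramanujanKernel 2 u : ℂ)) s / Gamma s) 1 := by
    refine (differentiableAt_mellin_ramanujanKernel two_pos h1re).continuousAt.div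
      (differentiableAt_Gamma 1 fun m hm => ?_).continuousAt (Gamma_ne_zero_of_re_pos h1re)
    have := congrArg re hm
    simp only [one_re, neg_re, natCast_re] at this
    linarith [Nat.cast_nonneg (α := ℝ) m]
  have hlim1 := (hcont.tendsto.mono_left nhdsWithin_le_nhds).comp hof
  have hderiv : HasDerivAt (fun s : ℂ => (2 : ℂ) ^ (1 - s)) (-(Real.log 2 : ℂ)) 1 := by
    have h := ((hasDerivAt_id' (1 : ℂ)).const_sub 1).const_cpow (c := 2) (Or.inl two_ne_zero)
    convert! h using 1
    simp
  have hslope := (hasDerivAt_iff_tendsto_slope.1 hderiv).comp hof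
  have hz := tendsto_riemannZeta_sub_one_div.comp hof
  have hlim2 := (hz.sub_const 1).sub hslope
  rw [Gamma_one, div_one] at hlim1
  rw [sub_neg_eq_add] at hlim2
  refine tendsto_nhds_unique (hlim1.congr' ?_) hlim2
  filter_upwards [self_mem_nhdsWithin] with r hr
  have hr : 1 < (r : ℂ).re := hr
  simp only [Function.comp]
  rw [mellin_ramanujanKernel_two hr, slope_def_field, sub_self, cpow_zero]

/-! ### Binomial transforms -/

/-- The binomial transform `m ↦ ∑ k ≤ m, C(m, k) a k` of the sequence `a`. -/
def binomialTransform (a : ℕ → ℂ) (m : ℕ) : ℂ :=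
  ∑ k ∈ Finset.range (m + 1), (m.choose k : ℂ) * a k

/-- The shift of sequences corresponds to the forward difference of binomial transforms. -/
lemma binomialTransform_succ (a : ℕ → ℂ) (m : ℕ) :
    binomialTransform a (m + 1) =
      binomialTransform a m + binomialTransform (fun k => a (k + 1)) m := by
  unfold binomialTransform
  rw [Finset.sum_range_succ' _ (m + 1)]
  have h1 : ∀ k, ((m + 1).choose (k + 1) : ℂ) * a (k + 1)
      = (m.choose k : ℂ) * a (k + 1) + (m.choose (k + 1) : ℂ) * a (k + 1) := by
    intro k
    rw [Nat.choose_succ_succ]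
    push_cast
    ring
  simp_rw [h1]
  rw [Finset.sum_add_distrib, Finset.sum_range_succ (fun k => (m.choose (k + 1) : ℂ) * a (k + 1)),
    Finset.sum_range_succ' (fun k => (m.choose k : ℂ) * a k)]
  simp
  ring

/-- Multiplication of the `k`-th term by `k` corresponds to `m` times the backward difference of
binomial transforms. -/
lemma binomialTransform_natCast_mul (a : ℕ → ℂ) (m : ℕ) :
    binomialTransform (fun k => k * a k) (m + 1) =
      (m + 1) * (binomialTransform a (m + 1) - binomialTransform a m) := by
  rw [binomialTransform_succ a m, add_sub_cancel_left]
  unfold binomialTransform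
  rw [Finset.sum_range_succ' _ (m + 1), Finset.mul_sum]
  simp only [Nat.cast_zero, zero_mul, mul_zero, add_zero]
  refine Finset.sum_congr rfl fun k _ => ?_
  have h : ((m : ℂ) + 1) * (m.choose k : ℂ) = ((m + 1).choose (k + 1) : ℂ) * (k + 1) := by
    exact_mod_cast Nat.add_one_mul_choose_eq m k
  push_cast
  linear_combination -(a (k + 1)) * h

lemma binomialTransform_pow (x : ℂ) (m : ℕ) : binomialTransform (fun k => x ^ k) m = (1 + x) ^ m := by
  rw [add_comm, add_pow, binomialTransform]
  refine Finset.sum_congr rfl fun k _ => ?_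
  rw [one_pow]
  ring

/-- The binomial transform of `(-1)^k / k` is minus the harmonic number; the term `k = 0` is `0`
by the convention `1 / 0 = 0`. -/
lemma binomialTransform_neg_one_pow_div (m : ℕ) :
    binomialTransform (fun k => (-1) ^ k / (k : ℂ)) m = -∑ k ∈ Finset.Icc 1 m, 1 / (k : ℂ) := by
  induction m with
  | zero => simp [binomialTransform]
  | succ m ih =>
    have hm : (m + 1 : ℂ) ≠ 0 := by exact_mod_cast m.succ_ne_zero
    -- multiplying the terms by `k` leaves `(-1)^k` with its term at `k = 0` removed
    have h1 := binomialTransform_natCast_mul (fun k => (-1) ^ k / (k : ℂ)) m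
    have h2 : binomialTransform (fun k : ℕ => (k : ℂ) * ((-1) ^ k / (k : ℂ))) (m + 1) = -1 := by
      have h3 := binomialTransform_pow (-1) (m + 1)
      unfold binomialTransform at h3 ⊢
      rw [Finset.sum_range_succ'] at h3 ⊢
      have h4 : ∀ k : ℕ, ((k + 1 : ℕ) : ℂ) * ((-1) ^ (k + 1) / ((k + 1 : ℕ) : ℂ)) = (-1) ^ (k + 1) :=
        fun k => mul_div_cancel₀ _ (Nat.cast_ne_zero.2 k.succ_ne_zero)
      simp_rw [h4]
      simp at h3 ⊢
      linear_combination h3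
    rw [h2, ih] at h1
    rw [Finset.sum_Icc_succ_top (by omega)]
    push_cast
    field_simp
    linear_combination -h1

/-! ### The polynomials `P m` -/

lemma P_eq_binomialTransform (m : ℕ) (s : ℂ) :
    P m s = 2 * binomialTransform
      (fun k => (-2) ^ k * ((ascPochhammer ℂ k).eval s / (k.factorial : ℂ))) m := by
  rw [P, binomialTransform, Finset.mul_sum]
  refine Finset.sum_congr rfl fun k _ => ?_
  rw [neg_pow 2]
  ring

lemma P_zero (s : ℂ) : P 0 s = 2 := by simp [P]

/-- The three-term recurrence; at `m = 0` the factor `m` makes the value of `m - 1` irrelevant. -/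
lemma succ_mul_P_succ (m : ℕ) (s : ℂ) :
    (m + 1) * P (m + 1) s = (1 - 2 * s) * P m s + m * P (m - 1) s := by
  set a : ℕ → ℂ := fun k => (-2) ^ k * ((ascPochhammer ℂ k).eval s / (k.factorial : ℂ)) with ha
  have hP : ∀ n, P n s = 2 * binomialTransform a n := fun n => P_eq_binomialTransform n s
  have hstep : ∀ k : ℕ, ((k + 1 : ℕ) : ℂ) * a (k + 1) = -2 * s * a k + -2 * (k * a k) := by
    intro k
    have hk : ((k : ℂ) + 1) ≠ 0 := by exact_mod_cast k.succ_ne_zero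
    have hf : (k.factorial : ℂ) ≠ 0 := by exact_mod_cast k.factorial_ne_zero
    simp only [ha]
    rw [ascPochhammer_succ_eval, Nat.factorial_succ]
    push_cast
    field_simp
    ring
  -- transform the first-order recurrence `hstep` of the coefficients
  have h1 : ∀ n, binomialTransform (fun k => k * a k) (n + 1)
      - binomialTransform (fun k => k * a k) n
      = -2 * s * binomialTransform a n + -2 * binomialTransform (fun k => k * a k) n := by
    intro n
    rw [binomialTransform_succ, add_sub_cancel_left]
    simp_rw [hstep]
    unfold binomialTransform
    rw [Finset.mul_sum, Finset.mul_sum, ← Finset.sum_add_distrib]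
    refine Finset.sum_congr rfl fun k _ => ?_
    ring
  rw [hP, hP, hP]
  have h2 := h1 m
  rw [binomialTransform_natCast_mul] at h2
  cases m with
  | zero =>
    have h0 : binomialTransform (fun k => k * a k) 0 = 0 := by simp [binomialTransform]
    rw [h0] at h2
    push_cast at h2 ⊢
    linear_combination 2 * h2
  | succ m =>
    rw [binomialTransform_natCast_mul] at h2
    rw [Nat.add_sub_cancel]
    push_cast at h2 ⊢
    linear_combination 2 * h2

/-- Polynomial growth of `P m s` in `m`, with the exponent any integer above `‖1 - 2s‖`: the
recurrence gives `‖P (m + 1) s‖ ≤ (‖1 - 2s‖ + m) / (m + 1)` times the bound for smaller indices. -/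
lemma exists_norm_P_le (s : ℂ) : ∃ N : ℕ, ∀ m : ℕ, ‖P m s‖ ≤ 2 * ((m : ℝ) + 1) ^ N := by
  obtain ⟨N, hN⟩ := exists_nat_ge ‖1 - 2 * s‖
  refine ⟨N, fun m => ?_⟩
  induction m using Nat.strong_induction_on with
  | _ m ih =>
    cases m with
    | zero => simp [P_zero]
    | succ m =>
      have h1 := ih m (by omega)
      have h2 : (m : ℝ) * ‖P (m - 1) s‖ ≤ m * (2 * ((m : ℝ) + 1) ^ N) := by
        gcongr
        refine (ih (m - 1) (by omega)).trans ?_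
        gcongr
        omega
      have h3 : ((m : ℝ) + 1) * ‖P (m + 1) s‖
          ≤ N * (2 * ((m : ℝ) + 1) ^ N) + m * (2 * ((m : ℝ) + 1) ^ N) := by
        have h4 : ((m : ℝ) + 1) * ‖P (m + 1) s‖ = ‖((m : ℂ) + 1) * P (m + 1) s‖ := by
          rw [norm_mul]
          congr 1
          exact_mod_cast (Complex.norm_natCast (m + 1)).symm
        rw [h4, succ_mul_P_succ]
        refine (norm_add_le _ _).trans (add_le_add ?_ ?_)
        · rw [norm_mul]
          gcongr
        · rw [norm_mul, Complex.norm_natCast]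
          exact h2
      have hm : (0 : ℝ) < (m : ℝ) + 1 := by positivity
      -- Bernoulli's inequality for `(1 + 1 / (m + 1)) ^ N`
      have h5 : 1 + (N : ℝ) * (1 / ((m : ℝ) + 1)) ≤ (1 + 1 / ((m : ℝ) + 1)) ^ N :=
        one_add_mul_le_pow (by
          have : 0 ≤ 1 / ((m : ℝ) + 1) := by positivity
          linarith) N
      have h6 : ((m : ℝ) + 1 + 1) ^ N = ((m : ℝ) + 1) ^ N * (1 + 1 / ((m : ℝ) + 1)) ^ N := by
        rw [← mul_pow]
        congr 1
        field_simp
      have h7 : ((m : ℝ) + 1) ^ N * (m + 1 + N) ≤ (m + 1) * ((m : ℝ) + 1 + 1) ^ N := by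
        rw [h6]
        calc ((m : ℝ) + 1) ^ N * (m + 1 + N)
            = (m + 1) * (((m : ℝ) + 1) ^ N * (1 + (N : ℝ) * (1 / ((m : ℝ) + 1)))) := by
              field_simp
          _ ≤ _ := by gcongr
      have h8 : 0 ≤ ((m : ℝ) + 1) ^ N := by positivity
      push_cast
      refine le_of_mul_le_mul_left ?_ hm
      linarith

/-! ### The generating function of the polynomials `P m` -/

lemma summable_add_one_pow_mul_geometric (N : ℕ) {r : ℝ} (hr0 : 0 < r) (hr1 : r < 1) :
    Summable fun m : ℕ => ((m : ℝ) + 1) ^ N * r ^ m := by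
  have h := (summable_nat_add_iff 1).2 (summable_pow_mul_geometric_of_norm_lt_one N
    (r := r) (by rwa [Real.norm_of_nonneg hr0.le]))
  refine (h.mul_left r⁻¹).congr fun m => ?_
  push_cast
  field_simp
  ring

lemma summable_P_mul_pow (s : ℂ) {x : ℂ} (hx : ‖x‖ < 1) :
    Summable fun m : ℕ => P m s * x ^ m := by
  obtain ⟨N, hN⟩ := exists_norm_P_le s
  obtain ⟨r, hr, hr1⟩ := exists_between hx
  have hr0 : 0 < r := (norm_nonneg x).trans_lt hr
  refine Summable.of_norm_bounded
    ((summable_add_one_pow_mul_geometric N hr0 hr1).mul_left 2) fun m => ?_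
  rw [norm_mul, norm_pow, ← mul_assoc]
  gcongr
  exact hN m

/-- The generating function `x ↦ ∑ m, P m s * x ^ m` on the unit disc. -/
noncomputable def genP (s x : ℂ) : ℂ := ∑' m : ℕ, P m s * x ^ m

/-- The generating function satisfies `(1 - x²) G' = (1 - 2s + x) G`. -/
lemma exists_hasDerivAt_genP (s : ℂ) {x : ℂ} (hx : ‖x‖ < 1) :
    ∃ D : ℂ, HasDerivAt (genP s) D x ∧ (1 - x ^ 2) * D = (1 - 2 * s + x) * genP s x := by
  obtain ⟨N, hN⟩ := exists_norm_P_le s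
  obtain ⟨r, hr, hr1⟩ := exists_between hx
  have hr0 : 0 < r := (norm_nonneg x).trans_lt hr
  set u : ℕ → ℝ := fun m => 2 * ((m : ℝ) + 1) ^ N * (m * r ^ (m - 1)) with hu
  have hu_sum : Summable u := by
    refine Summable.of_nonneg_of_le (fun m => by positivity) (fun m => ?_)
      ((summable_add_one_pow_mul_geometric (N + 1) hr0 hr1).mul_left (2 * r⁻¹))
    cases m with
    | zero =>
      simp only [hu, Nat.cast_zero]
      simp only [zero_mul, mul_zero]
      positivity
    | succ m =>
      simp only [hu, Nat.add_sub_cancel]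
      have h1 : 2 * r⁻¹ * ((((m + 1 : ℕ) : ℝ) + 1) ^ (N + 1) * r ^ (m + 1))
          = 2 * (((m + 1 : ℕ) : ℝ) + 1) ^ N * ((((m + 1 : ℕ) : ℝ) + 1) * r ^ m) := by
        field_simp
        ring
      rw [h1]
      gcongr
      linarith
  have hball : ∀ y ∈ Metric.ball (0 : ℂ) r, ‖y‖ < r := fun y hy => by simpa using hy
  have hbound : ∀ (m : ℕ), ∀ y ∈ Metric.ball (0 : ℂ) r,
      ‖P m s * ((m : ℂ) * y ^ (m - 1))‖ ≤ u m := by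
    intro m y hy
    rw [norm_mul, norm_mul, norm_pow, Complex.norm_natCast]
    have h1 := hN m
    have h2 := (hball y hy).le
    simp only [hu]
    gcongr
  have hderiv := hasDerivAt_tsum_of_isPreconnected (g := fun m y => P m s * y ^ m)
    (g' := fun m y => P m s * ((m : ℂ) * y ^ (m - 1))) (y₀ := x) (y := x) hu_sum
    Metric.isOpen_ball (convex_ball (0 : ℂ) r).isPreconnected
    (fun m y _ => (hasDerivAt_pow m y).const_mul _) hbound (by simpa using hr)
    (summable_P_mul_pow s hx) (by simpa using hr)
  set D : ℂ := ∑' m : ℕ, P m s * ((m : ℂ) * x ^ (m - 1)) with hD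
  refine ⟨D, hderiv, ?_⟩
  have hDs : HasSum (fun m : ℕ => P m s * ((m : ℂ) * x ^ (m - 1))) D :=
    (Summable.of_norm_bounded hu_sum fun m => hbound m x (by simpa using hr)).hasSum
  have hGs : HasSum (fun m : ℕ => P m s * x ^ m) (genP s x) :=
    (summable_P_mul_pow s hx).hasSum
  have h1 : HasSum (fun m : ℕ => ((m : ℂ) + 1) * P (m + 1) s * x ^ m) D := by
    have h := (hasSum_nat_add_iff' 1).2 hDs
    simp only [Finset.range_one, Finset.sum_singleton, Nat.cast_zero, zero_mul, mul_zero,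
      sub_zero, Nat.add_sub_cancel] at h
    refine h.congr_fun fun m => ?_
    push_cast
    ring
  have h2 : HasSum (fun m : ℕ => (m : ℂ) * P (m - 1) s * x ^ m) (x ^ 2 * D + x * genP s x) := by
    have h := (hDs.mul_left (x ^ 2)).add (hGs.mul_left x)
    have h' : HasSum (fun m : ℕ => ((m + 1 : ℕ) : ℂ) * P (m + 1 - 1) s * x ^ (m + 1))
        (x ^ 2 * D + x * genP s x) := by
      refine h.congr_fun fun m => ?_
      cases m with
      | zero => simp; ring
      | succ m =>
        simp only [Nat.add_sub_cancel]
        push_cast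
        ring
    have h'' := (hasSum_nat_add_iff (f := fun m : ℕ => (m : ℂ) * P (m - 1) s * x ^ m) 1).1 h'
    simpa using h''
  have h3 : HasSum (fun m : ℕ => ((m : ℂ) + 1) * P (m + 1) s * x ^ m)
      ((1 - 2 * s) * genP s x + (x ^ 2 * D + x * genP s x)) := by
    refine ((hGs.mul_left (1 - 2 * s)).add h2).congr_fun fun m => ?_
    rw [succ_mul_P_succ]
    ring
  linear_combination h1.unique h3

/-! ### Expansion of `w ^ (-s)` in powers of `(w - 1) / (w + 1)` -/

lemma add_one_ne_zero_of_re_pos {w : ℂ} (hw : 0 < w.re) : w + 1 ≠ 0 := by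
  intro h
  have := congrArg re h
  simp only [add_re, one_re, zero_re] at this
  linarith

lemma norm_sub_one_div_add_one_lt_one {w : ℂ} (hw : 0 < w.re) : ‖(w - 1) / (w + 1)‖ < 1 := by
  rw [norm_div, div_lt_one (norm_pos_iff.2 (add_one_ne_zero_of_re_pos hw))]
  refine lt_of_pow_lt_pow_left₀ 2 (norm_nonneg _) ?_
  rw [← normSq_eq_norm_sq, ← normSq_eq_norm_sq, normSq_apply, normSq_apply]
  simp only [sub_re, add_re, one_re, sub_im, add_im, one_im]
  nlinarith

lemma genP_zero (s : ℂ) : genP s 0 = 2 := by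
  rw [genP, tsum_eq_single 0 fun m hm => by rw [zero_pow hm, mul_zero], P_zero]
  simp

/-- The differential equation of the generating function makes the product of the left side with
`w ^ s` constant on the half plane. -/
lemma inv_add_one_mul_genP (s : ℂ) {w : ℂ} (hw : 0 < w.re) :
    (w + 1)⁻¹ * genP s ((w - 1) / (w + 1)) = w ^ (-s) := by
  set E : ℂ → ℂ := fun w => (w + 1)⁻¹ * genP s ((w - 1) / (w + 1)) * w ^ s with hE
  have hderiv : ∀ v : ℂ, 0 < v.re → HasDerivAt E 0 v := by
    intro v hv
    have hv1 := add_one_ne_zero_of_re_pos hv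
    have hv0 : v ≠ 0 := by
      rintro rfl
      simp at hv
    obtain ⟨D, hD, hode⟩ := exists_hasDerivAt_genP s (norm_sub_one_div_add_one_lt_one hv)
    have hnum : HasDerivAt (fun w : ℂ => w - 1) 1 v := (hasDerivAt_id' v).sub_const 1
    have hden : HasDerivAt (fun w : ℂ => w + 1) 1 v := (hasDerivAt_id' v).add_const 1
    have hx := hnum.fun_div hden hv1
    have hpow := (hasDerivAt_id' v).cpow_const (c := s) (Or.inl hv : v ∈ slitPlane)
    have h := ((hden.fun_inv hv1).fun_mul (hD.comp v hx)).fun_mul hpow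
    convert! h using 1
    rw [cpow_sub _ _ hv0, cpow_one]
    simp only [Function.comp]
    set G := genP s ((v - 1) / (v + 1))
    have hode' : 2 * v * D = (v + 1) * (v - s * (v + 1)) * G := by
      field_simp at hode
      linear_combination (1 / 2) * hode
    field_simp
    linear_combination -(v ^ s) * hode'
  have hconst : E w = E 1 := isOpen_re_pos.is_const_of_deriv_eq_zero isPreconnected_re_pos
    (fun v hv => (hderiv v hv).differentiableAt.differentiableWithinAt)
    (fun v hv => (hderiv v hv).deriv) hw (by simp)
  have hE1 : E 1 = 1 := by
    simp only [hE, sub_self, zero_div, genP_zero, one_cpow]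
    norm_num
  rw [hE1] at hconst
  rw [cpow_neg]
  exact eq_inv_of_mul_eq_one_left hconst

lemma hasSum_P_mul (s : ℂ) {w : ℂ} (hw : 0 < w.re) :
    HasSum (fun m : ℕ => P m s * (1 / (w + 1) * ((w - 1) / (w + 1)) ^ m)) (w ^ (-s)) := by
  have h := (summable_P_mul_pow s (norm_sub_one_div_add_one_lt_one hw)).hasSum.mul_left
    (w + 1)⁻¹
  rw [← inv_add_one_mul_genP s hw]
  refine h.congr_fun fun m => ?_
  ring

/-! ### Bounds for the Plana integrands -/

/-- The summand `w ↦ ((w - 1) / (w + 1)) ^ m / (w + 1)`. -/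
noncomputable def mobiusTerm (m : ℕ) (w : ℂ) : ℂ := 1 / (w + 1) * ((w - 1) / (w + 1)) ^ m

lemma memE_mobiusTerm (m : ℕ) : MemE Real.pi (mobiusTerm m) := by
  refine ⟨?_, 0, 1, Real.pi_pos, one_pos, fun ε hε => ⟨1, fun w hw => ?_⟩⟩
  · intro w hw
    have h1 := add_one_ne_zero_of_re_pos hw
    have h2 : DifferentiableAt ℂ (fun w : ℂ => w + 1) w := by fun_prop
    have h3 : DifferentiableAt ℂ (fun w : ℂ => w - 1) w := by fun_prop
    have h4 : DifferentiableAt ℂ (fun w : ℂ => 1 / (w + 1)) w :=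
      (differentiableAt_const _).fun_div h2 h1
    exact (h4.fun_mul ((h3.fun_div h2 h1).fun_pow m)).differentiableWithinAt
  · have hw : 0 < w.re := hε.trans hw
    have h1 : ‖1 / (w + 1)‖ ≤ 1 := by
      rw [norm_div, norm_one]
      refine div_le_one_of_le₀ (le_trans ?_ (re_le_norm _)) (norm_nonneg _)
      simp only [add_re, one_re]
      linarith
    have h2 : 1 ≤ Real.exp (1 * w.re) := Real.one_le_exp (by linarith)
    rw [zero_mul, Real.exp_zero, mul_one, one_mul, mobiusTerm, norm_mul, norm_pow]
    exact (mul_le_one₀ h1 (by positivity) (pow_le_one₀ (norm_nonneg _)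
      (norm_sub_one_div_add_one_lt_one hw).le)).trans h2

/-- On the line `Re w = 1` the difference of the two conjugate values gains a factor `t`, which
cancels the singularity of `1 / (e^(2πt) - 1)` at `t = 0`. For `m ≥ 1` it is taken from one of the
`m` factors `(w - 1) / (w + 1)`, which explains the exponent `m - 1`. -/
lemma norm_mobiusTerm_sub_le (m : ℕ) {t : ℝ} (ht : 0 < t) :
    ‖mobiusTerm m (1 + I * t) - mobiusTerm m (1 - I * t)‖
      ≤ t * (t / √(4 + t ^ 2)) ^ (m - 1) := by
  have hpos : (0 : ℝ) < 4 + t ^ 2 := by positivity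
  have hsq : 2 ≤ √(4 + t ^ 2) := Real.le_sqrt_of_sq_le (by nlinarith)
  have hn1 : ‖(2 + I * t : ℂ)‖ = √(4 + t ^ 2) := by
    rw [Complex.norm_eq_sqrt_sq_add_sq]
    simp
    norm_num
  have hn2 : ‖(2 - I * t : ℂ)‖ = √(4 + t ^ 2) := by
    rw [Complex.norm_eq_sqrt_sq_add_sq]
    simp
    norm_num
  have hnz1 : (2 + I * t : ℂ) ≠ 0 := by
    rw [← norm_pos_iff, hn1]
    positivity
  have hnz2 : (2 - I * t : ℂ) ≠ 0 := by
    rw [← norm_pos_iff, hn2]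
    positivity
  have hf1 : mobiusTerm m (1 + I * t) = 1 / (2 + I * t) * (I * t / (2 + I * t)) ^ m := by
    rw [mobiusTerm]
    ring_nf
  have hf2 : mobiusTerm m (1 - I * t) = 1 / (2 - I * t) * (-(I * t) / (2 - I * t)) ^ m := by
    rw [mobiusTerm]
    ring_nf
  rw [hf1, hf2]
  cases m with
  | zero =>
    have h : 1 / (2 + I * t) * (I * t / (2 + I * t)) ^ 0
        - 1 / (2 - I * t) * (-(I * t) / (2 - I * t)) ^ 0
        = -(2 * I * t) / ((2 + I * t) * (2 - I * t)) := by
      field_simp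
      ring
    rw [h, norm_div, norm_mul, hn1, hn2, Real.mul_self_sqrt hpos.le]
    simp only [norm_neg, norm_mul, norm_I, norm_real, Real.norm_of_nonneg ht.le, Complex.norm_ofNat,
      mul_one, zero_tsub, pow_zero]
    rw [div_le_iff₀ hpos]
    nlinarith [mul_pos ht (pow_pos ht 2)]
  | succ j =>
    have hIt : ‖(I * t : ℂ)‖ = t := by simp [abs_of_pos ht]
    have hρ : t / √(4 + t ^ 2) ≤ t / 2 := by gcongr
    have hi : 1 / √(4 + t ^ 2) ≤ 1 / 2 := by gcongr
    have hb : 1 / √(4 + t ^ 2) * (t / √(4 + t ^ 2)) ^ (j + 1)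
        ≤ 1 / 2 * (t * (t / √(4 + t ^ 2)) ^ j) := by
      rw [pow_succ' _ j, ← mul_assoc, ← mul_assoc]
      gcongr
      linarith
    refine (norm_sub_le _ _).trans ?_
    rw [norm_mul, norm_mul, norm_pow, norm_pow, norm_div, norm_div, norm_div, norm_div, norm_neg,
      norm_one, hn1, hn2, hIt, Nat.add_sub_cancel]
    linarith

/-- The powers of `t / √(4 + t²)` decay faster than any power of `m`, at the price of a factor
polynomial in `t`. -/
lemma div_sqrt_pow_le (q m : ℕ) {t : ℝ} (ht : 0 < t) :
    (t / √(4 + t ^ 2)) ^ (m - 1)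
      ≤ Real.exp 1 * (q.factorial * ((4 + t ^ 2) / 2) ^ q / ((m : ℝ) + 1) ^ q) := by
  have hpos : (0 : ℝ) < 4 + t ^ 2 := by positivity
  set y : ℝ := 2 / (4 + t ^ 2) with hy
  have hy0 : 0 < y := by positivity
  have hy2 : y ≤ 1 / 2 := by
    rw [hy, div_le_div_iff₀ hpos two_pos]
    nlinarith [sq_nonneg t]
  have h1 : t / √(4 + t ^ 2) ≤ Real.exp (-y) := by
    have h2 : t / √(4 + t ^ 2) ≤ 1 - y := by
      refine (pow_le_pow_iff_left₀ (by positivity) (by linarith) two_ne_zero).1 ?_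
      rw [div_pow, Real.sq_sqrt hpos.le]
      have h3 : t ^ 2 / (4 + t ^ 2) = 1 - 2 * y := by
        rw [hy]
        field_simp
        ring
      rw [h3]
      nlinarith [sq_nonneg y]
    linarith [Real.add_one_le_exp (-y)]
  -- with truncated subtraction this holds at `m = 0` too
  have h4 : (m : ℝ) - 1 ≤ ((m - 1 : ℕ) : ℝ) := by
    rw [sub_le_iff_le_add]
    exact_mod_cast Nat.le_add_of_sub_le le_rfl
  have h5 := Real.pow_div_factorial_le_exp (((m : ℝ) + 1) * y) (by positivity) q
  calc (t / √(4 + t ^ 2)) ^ (m - 1) ≤ Real.exp (-y) ^ (m - 1) := by gcongr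
    _ = Real.exp (-(((m - 1 : ℕ) : ℝ) * y)) := by
      rw [← Real.exp_nat_mul]
      ring_nf
    _ ≤ Real.exp (1 - ((m : ℝ) + 1) * y) := by
      gcongr
      nlinarith
    _ = Real.exp 1 * (Real.exp (((m : ℝ) + 1) * y))⁻¹ := by
      rw [Real.exp_sub, div_eq_mul_inv]
    _ ≤ Real.exp 1 * ((((m : ℝ) + 1) * y) ^ q / q.factorial)⁻¹ := by
      gcongr
    _ = _ := by
      rw [hy, mul_pow, div_pow, div_pow]
      congr 1
      field_simp

/-- The Plana integrands decay faster than any power of `m`, with an exponentially decaying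
majorant in `t`. -/
lemma exists_norm_planaIntegrand_le (q : ℕ) : ∃ K : ℝ, 0 ≤ K ∧ ∀ (m : ℕ) (t : ℝ), 0 < t →
    ‖planaIntegrand (mobiusTerm m) t‖ ≤ K / ((m : ℝ) + 1) ^ q * Real.exp (-(1 * t)) := by
  refine ⟨Real.exp 1 * q.factorial * (2 ^ q * ((2 * q).factorial * Real.exp 1)), by positivity,
    fun m t ht => ?_⟩
  have hE := exp_two_pi_sub_one_pos ht
  have h1 : ((4 + t ^ 2) / 2) ^ q ≤ 2 ^ q * ((2 * q).factorial * Real.exp (1 + t)) := by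
    have h2 := Real.pow_div_factorial_le_exp (1 + t) (by positivity) (2 * q)
    rw [div_le_iff₀ (by positivity)] at h2
    calc ((4 + t ^ 2) / 2) ^ q ≤ (2 * (1 + t) ^ 2) ^ q := by
          gcongr
          nlinarith [sq_nonneg t]
      _ = 2 ^ q * (1 + t) ^ (2 * q) := by rw [mul_pow, pow_mul]
      _ ≤ _ := by
          gcongr
          linarith
  rw [planaIntegrand, norm_div, norm_real, Real.norm_of_nonneg hE.le]
  calc ‖mobiusTerm m (1 + I * t) - mobiusTerm m (1 - I * t)‖ / (Real.exp (2 * Real.pi * t) - 1)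
      ≤ (t * (t / √(4 + t ^ 2)) ^ (m - 1)) / (Real.exp (2 * Real.pi * t) - 1) := by
        gcongr
        exact norm_mobiusTerm_sub_le m ht
    _ = (t / √(4 + t ^ 2)) ^ (m - 1) * (t / (Real.exp (2 * Real.pi * t) - 1)) := by ring
    _ ≤ Real.exp 1 * (q.factorial * (2 ^ q * ((2 * q).factorial * Real.exp (1 + t)))
          / ((m : ℝ) + 1) ^ q) * Real.exp (-(Real.pi * t)) := by
        gcongr
        · exact (div_sqrt_pow_le q m ht).trans (by gcongr)
        · exact div_exp_two_pi_sub_one_le ht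
    _ = Real.exp 1 * q.factorial * (2 ^ q * ((2 * q).factorial * Real.exp 1))
          / ((m : ℝ) + 1) ^ q * Real.exp (t - Real.pi * t) := by
        rw [Real.exp_add, sub_eq_add_neg, Real.exp_add t]
        ring
    _ ≤ _ := by
        gcongr
        nlinarith [Real.pi_gt_three]

/-! ### The Ramanujan sums `z m` -/

lemma mobiusTerm_eq_sum (m : ℕ) {w : ℂ} (hw : w + 1 ≠ 0) :
    mobiusTerm m w = ∑ k ∈ Finset.range (m + 1),
      (m.choose k : ℂ) * (-2) ^ k * (w + (2 - 1 : ℝ)) ^ (-((k : ℂ) + 1)) := by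
  have h1 : (w - 1) / (w + 1) = 1 + -2 / (w + 1) := by
    field_simp
    ring
  rw [mobiusTerm, h1, ← binomialTransform_pow, binomialTransform, Finset.mul_sum]
  refine Finset.sum_congr rfl fun k _ => ?_
  have h2 : (w + (2 - 1 : ℝ)) ^ (-((k : ℂ) + 1)) = ((w + 1) ^ (k + 1))⁻¹ := by
    rw [cpow_neg]
    norm_num
    exact_mod_cast cpow_natCast (w + 1) (k + 1)
  rw [h2, div_pow]
  field_simp
  ring

lemma planaIntegrand_mobiusTerm (m : ℕ) (t : ℝ) :
    planaIntegrand (mobiusTerm m) t = ∑ k ∈ Finset.range (m + 1), (m.choose k : ℂ) * (-2) ^ k *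
      planaIntegrand (fun w => (w + (2 - 1 : ℝ)) ^ (-((k : ℂ) + 1))) t := by
  have h1 : (1 + I * t : ℂ) + 1 ≠ 0 := add_one_ne_zero_of_re_pos (by simp)
  have h2 : (1 - I * t : ℂ) + 1 ≠ 0 := add_one_ne_zero_of_re_pos (by simp)
  rw [planaIntegrand, mobiusTerm_eq_sum m h1, mobiusTerm_eq_sum m h2, ← Finset.sum_sub_distrib,
    Finset.sum_div]
  refine Finset.sum_congr rfl fun k _ => ?_
  rw [planaIntegrand]
  ring

lemma natCast_add_one_re_pos (k : ℕ) : 0 < ((k : ℂ) + 1).re := by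
  simp only [add_re, natCast_re, one_re]
  positivity

lemma integrableOn_planaIntegrand_mobiusTerm (m : ℕ) :
    IntegrableOn (planaIntegrand (mobiusTerm m)) (Ioi 0) := by
  rw [funext (planaIntegrand_mobiusTerm m)]
  exact integrable_finsetSum _ fun k _ =>
    (plana_cpow (natCast_add_one_re_pos k) two_pos).1.const_mul _

/-- The Ramanujan sum of `(n + 1)^(-(k + 1))` for `k ≥ 1`. -/
lemma mellin_ramanujanKernel_two_natCast (k : ℕ) :
    mellin (fun u => (ramanujanKernel 2 u : ℂ)) (((k + 1 : ℕ) : ℂ) + 1)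
        / Gamma (((k + 1 : ℕ) : ℂ) + 1)
      = riemannZeta (((k + 1 : ℕ) : ℂ) + 1) - 1
        - 1 / (2 ^ (k + 1) * ((k + 1 : ℕ) : ℂ)) := by
  have hs : 1 < (((k + 1 : ℕ) : ℂ) + 1).re := by
    simp only [add_re, natCast_re, one_re]
    push_cast
    linarith [Nat.cast_nonneg (α := ℝ) k]
  have hk : ((k + 1 : ℕ) : ℂ) ≠ 0 := Nat.cast_ne_zero.2 k.succ_ne_zero
  rw [mellin_ramanujanKernel_two hs, add_sub_cancel_right, sub_add_cancel_right, cpow_neg,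
    cpow_natCast]
  field_simp
  ring

/-- The Ramanujan sum of the `m`-th term is the explicit number `z m`. -/
lemma plana_mobiusTerm (m : ℕ) :
    mobiusTerm m 1 / 2 + I * ∫ t in Ioi (0 : ℝ), planaIntegrand (mobiusTerm m) t = z m := by
  have h1 : (1 : ℂ) + 1 ≠ 0 := by norm_num
  have hR : ∀ k : ℕ, _ := fun k => (plana_cpow (natCast_add_one_re_pos k) two_pos).2
  have hint : ∫ t in Ioi (0 : ℝ), planaIntegrand (mobiusTerm m) t
      = ∑ k ∈ Finset.range (m + 1), (m.choose k : ℂ) * (-2) ^ k *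
        ∫ t in Ioi (0 : ℝ), planaIntegrand (fun w => (w + (2 - 1 : ℝ)) ^ (-((k : ℂ) + 1))) t := by
    simp_rw [planaIntegrand_mobiusTerm]
    rw [integral_finsetSum _ fun k _ =>
      (plana_cpow (natCast_add_one_re_pos k) two_pos).1.const_mul _]
    simp_rw [integral_const_mul]
  have hS : mobiusTerm m 1 / 2 + I * ∫ t in Ioi (0 : ℝ), planaIntegrand (mobiusTerm m) t
      = ∑ k ∈ Finset.range (m + 1), (m.choose k : ℂ) * (-2) ^ k *
        (mellin (fun u => (ramanujanKernel 2 u : ℂ)) ((k : ℂ) + 1) / Gamma ((k : ℂ) + 1)) := by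
    rw [hint, mobiusTerm_eq_sum m h1, Finset.sum_div, Finset.mul_sum, ← Finset.sum_add_distrib]
    refine Finset.sum_congr rfl fun k _ => ?_
    have h2 : ((1 : ℂ) + (2 - 1 : ℝ)) = (2 : ℝ) := by norm_num
    rw [← hR k, h2]
    ring
  have hpow := binomialTransform_pow (-2) m
  have hharm := binomialTransform_neg_one_pow_div m
  have hIcc : ∀ f : ℕ → ℂ, ∑ k ∈ Finset.Icc 1 m, f k = ∑ k ∈ Finset.range m, f (k + 1) := by
    intro f
    rw [Finset.range_eq_Ico, Finset.sum_Ico_add' f 0 m 1]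
    rfl
  rw [binomialTransform, Finset.sum_range_succ'] at hpow hharm
  rw [hS, Finset.sum_range_succ', z]
  simp only [Nat.cast_zero, zero_add, div_one, Gamma_one, mellin_ramanujanKernel_two_one,
    mellin_ramanujanKernel_two_natCast, Nat.choose_zero_right, Nat.cast_one, pow_zero, one_mul,
    mul_one, div_zero, mul_zero, add_zero] at hpow hharm ⊢
  rw [hIcc fun k => (m.choose k : ℂ) * (-2) ^ k * riemannZeta ((k : ℂ) + 1)]
  have hsplit : ∀ k : ℕ, (m.choose (k + 1) : ℂ) * (-2) ^ (k + 1) *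
      (riemannZeta (((k + 1 : ℕ) : ℂ) + 1) - 1 - 1 / (2 ^ (k + 1) * ((k + 1 : ℕ) : ℂ)))
      = (m.choose (k + 1) : ℂ) * (-2) ^ (k + 1) * riemannZeta (((k + 1 : ℕ) : ℂ) + 1)
        - (m.choose (k + 1) : ℂ) * (-2) ^ (k + 1)
        - (m.choose (k + 1) : ℂ) * ((-1) ^ (k + 1) / ((k + 1 : ℕ) : ℂ)) := by
    intro k
    have hk : ((k + 1 : ℕ) : ℂ) ≠ 0 := Nat.cast_ne_zero.2 k.succ_ne_zero
    rw [neg_pow (2 : ℂ) (k + 1)]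
    field_simp
  simp_rw [hsplit]
  rw [Finset.sum_sub_distrib, Finset.sum_sub_distrib, hharm, eq_sub_of_add_eq hpow, pow_succ]
  norm_num
  ring

/-! ### Exchange of the sum and the Plana integral -/

/-- The Ramanujan sum of the expansion of `w ^ (-s)`, taken term by term. The bound with exponent
`N + 2` absorbs the growth `m ^ N` of `P m s` and leaves a summable factor `1 / m ^ 2`. -/
lemma hasSum_z_mul_P {s : ℂ} (hs : 0 < s.re) :
    HasSum (fun m => z m * P m s) (zetaRegular s) := by
  obtain ⟨N, hN⟩ := exists_norm_P_le s
  obtain ⟨K, hK0, hK⟩ := exists_norm_planaIntegrand_le (N + 2)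
  have hpow : HasSum (fun m => P m s * mobiusTerm m 1) 1 := by
    simpa [mobiusTerm] using hasSum_P_mul s (w := 1) (by simp)
  have hint := hasSum_integral_of_summable_integral_norm (μ := volume.restrict (Ioi (0 : ℝ)))
    (F := fun (m : ℕ) (t : ℝ) => P m s * planaIntegrand (mobiusTerm m) t)
    (fun m => (integrableOn_planaIntegrand_mobiusTerm m).const_mul _) ?_
  · have hfun : ∫ t in Ioi (0 : ℝ), ∑' m : ℕ, P m s * planaIntegrand (mobiusTerm m) t
        = ∫ t in Ioi (0 : ℝ), planaIntegrand (fun w => (w + (1 - 1 : ℝ)) ^ (-s)) t := by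
      refine setIntegral_congr_fun measurableSet_Ioi fun t _ => ?_
      have h1 := hasSum_P_mul s (w := 1 + I * t) (by simp)
      have h2 := hasSum_P_mul s (w := 1 - I * t) (by simp)
      have h3 := (h1.sub h2).div_const ((Real.exp (2 * Real.pi * t) - 1 : ℝ) : ℂ)
      simp only [planaIntegrand, sub_self, ofReal_zero, add_zero]
      rw [← h3.tsum_eq]
      refine tsum_congr fun m => ?_
      rw [mobiusTerm, mobiusTerm]
      ring
    rw [hfun] at hint
    have htot := (hpow.div_const 2).add (hint.mul_left I)
    have hR := (plana_cpow hs one_pos).2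
    rw [mellin_ramanujanKernel_one hs, ofReal_one, one_cpow] at hR
    rw [hR] at htot
    refine htot.congr_fun fun m => ?_
    rw [integral_const_mul, ← plana_mobiusTerm]
    ring
  · have hsum : Summable fun m : ℕ => 2 * K * (1 / ((m : ℝ) + 1) ^ 2) := by
      have h := (summable_nat_add_iff 1).2 (Real.summable_one_div_nat_pow.2 one_lt_two)
      refine (h.mul_left (2 * K)).congr fun m => ?_
      push_cast
      rfl
    refine Summable.of_nonneg_of_le (fun m => by positivity) (fun m => ?_) hsum
    have hexp : ∫ t in Ioi (0 : ℝ), Real.exp (-(1 * t)) = 1 := by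
      simpa only [one_mul] using integral_exp_neg_Ioi_zero
    have hm : (0 : ℝ) < (m : ℝ) + 1 := by positivity
    calc ∫ t in Ioi (0 : ℝ), ‖P m s * planaIntegrand (mobiusTerm m) t‖
        ≤ ∫ t in Ioi (0 : ℝ), 2 * ((m : ℝ) + 1) ^ N * (K / ((m : ℝ) + 1) ^ (N + 2)) *
            Real.exp (-(1 * t)) := by
          refine setIntegral_mono_on
            ((integrableOn_planaIntegrand_mobiusTerm m).const_mul _).norm
            ((integrableOn_exp_neg_mul one_pos).const_mul _) measurableSet_Ioi fun t ht => ?_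
          rw [norm_mul, mul_assoc]
          exact mul_le_mul (hN m) (hK m t ht) (norm_nonneg _) (by positivity)
      _ = 2 * K * (1 / ((m : ℝ) + 1) ^ 2) := by
          rw [integral_const_mul, hexp]
          field_simp
          ring

end ZetaStrip

theorem theorem7 :
    (∀ m : ℕ, ZetaStrip.HasRamanujanSum
      (fun w : ℂ => 1 / (w + 1) * ((w - 1) / (w + 1)) ^ m) (ZetaStrip.z m)) ∧
    ∀ s : ℂ, 0 < s.re → s.re < 1 →
      Summable (fun m : ℕ => ZetaStrip.z m * ZetaStrip.P m s) ∧
      riemannZeta s = 1 / (s - 1) + ∑' m : ℕ, ZetaStrip.z m * ZetaStrip.P m s := by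
  refine ⟨fun m => ⟨ZetaStrip.memE_mobiusTerm m, ZetaStrip.integrableOn_planaIntegrand_mobiusTerm m,
    ZetaStrip.plana_mobiusTerm m⟩, fun s hs0 hs1 => ?_⟩
  have hs : s ≠ 1 := by
    rintro rfl
    simp at hs1
  have h := ZetaStrip.hasSum_z_mul_P hs0
  refine ⟨h.summable, ?_⟩
  rw [h.tsum_eq, ZetaStrip.zetaRegular_of_ne hs]
  ring
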